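/- Let $\alpha,\beta,n>0$ and $0<r_0\le R$ be real constants, let $r:[0,\infty)\to\mathbb R$ be Lebesgue measurable with $r_0\le r(t)\le R$, and let $h:[0,\infty)\to\mathbb R$ be Lebesgue measurable with $h(t)\le t$ and $t-h(t)\le h_0$ for all $t\ge 0$. Let $K$ be the unique positive solution of $\beta K^{n+1}=\alpha(1+K^n)$, and put $$\mu=\frac{\alpha}{\beta},\quad M=\frac{\alpha}{\beta}\left[1+\left(\frac{\beta}{\alpha}\right)^n\right],\quad c=\ln\frac{\mu}{K},\quad C=\ln\frac{M}{K},$$ $$a_0=\frac{\alpha}{K}\,\frac{1-e^{-C}}{C}\,r_0,\qquad A=\frac{\alpha}{K}\,\frac{1-e^{-c}}{c}\,R,\qquad b_0=\frac{\beta nR}{4}.$$ Suppose that $$\frac{a_0}{b_0}\,e^{-Ah_0}>\ln\frac{b_0^2+a_0b_0}{b_0^2+a_0^2}.$$ Let $\varphi:(-\infty,0]\to[0,\infty)$ be bounded and Borel measurable with $\varphi(0)>0$. Then every solution $x$ of $$\dot x(t)=r(t)\left[\alpha-\frac{\beta\,x(t)\,x^n(h(t))}{1+x^n(h(t))}\right],\quad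 t\ge 0,\qquad x(t)=\varphi(t),\quad t\le 0,$$ that is, every function $x:\mathbb R\to\mathbb R$ that is locally absolutely continuous on $[0,\infty)$, satisfies the differential equation for almost all $t\ge 0$ and equals $\varphi$ on $(-\infty,0]$, satisfies $\lim_{t\to\infty}x(t)=K$. -/

import Mathlib

open MeasureTheory Set Filter Topology

namespace MackeyGlass

/-- `x` is a solution of the Mackey-Glass respiratory equation
`x'(t) = r(t) * (α - β * x(t) * x(h(t))^n / (1 + x(h(t))^n))` for almost all `t ≥ 0`,
with `x(t) = φ(t)` for `t ≤ 0`, where `x` is absolutely continuous on `[0, T]` for every `T`. -/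
structure IsSolution (α β n : ℝ) (r h φ x : ℝ → ℝ) : Prop where
  absCont : ∀ T : ℝ, 0 ≤ T → AbsolutelyContinuousOnInterval x 0 T
  deriv_eq : ∀ᵐ t ∂(volume.restrict (Ici (0 : ℝ))),
    HasDerivAt x (r t * (α - β * x t * x (h t) ^ n / (1 + x (h t) ^ n))) t
  initial : ∀ t : ℝ, t ≤ 0 → x t = φ t

/-- `K` is the positive equilibrium: the (unique) positive root of `β K^(n+1) = α (1 + K^n)`. -/
def IsPositiveEquilibrium (α β n K : ℝ) : Prop :=
  0 < K ∧ β * K ^ (n + 1) = α * (1 + K ^ n)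

/-- The asymptotic lower bound `μ = α / β`. -/
noncomputable def lowerBound (α β : ℝ) : ℝ := α / β

/-- The asymptotic upper bound `M = (α / β) (1 + (β / α)^n)`. -/
noncomputable def upperBound (α β n : ℝ) : ℝ := α / β * (1 + (β / α) ^ n)

/-- `c = ln (μ / K)`. -/
noncomputable def logLower (α β K : ℝ) : ℝ := Real.log (lowerBound α β / K)

/-- `C = ln (M / K)`. -/
noncomputable def logUpper (α β n K : ℝ) : ℝ := Real.log (upperBound α β n / K)

/-- `a₀ = (α / K) ((1 - e^(-C)) / C) r₀`. -/
noncomputable def coeffLower (α β n K r₀ : ℝ) : ℝ :=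
  α / K * ((1 - Real.exp (-logUpper α β n K)) / logUpper α β n K) * r₀

/-- `A = (α / K) ((1 - e^(-c)) / c) R`. -/
noncomputable def coeffUpper (α β K R : ℝ) : ℝ :=
  α / K * ((1 - Real.exp (-logLower α β K)) / logLower α β K) * R

/-- `b₀ = β n R / 4`. -/
noncomputable def delayCoeff (β n R : ℝ) : ℝ := β * n * R / 4

/-- `(a₀ / b₀) e^(-A h₀) > ln ((b₀² + a₀ b₀) / (b₀² + a₀²))`. -/
def StabilityInequality (a₀ A b₀ h₀ : ℝ) : Prop :=
  a₀ / b₀ * Real.exp (-(A * h₀)) > Real.log ((b₀ ^ 2 + a₀ * b₀) / (b₀ ^ 2 + a₀ ^ 2))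

end MackeyGlass

/-!
Comparison shows that `x` is eventually confined to `[μ, M]`. There `y = log (x / K)` satisfies the
linear equation `y' = -a y - b y(h)` with coefficients depending on the solution, `a₀ ≤ a ≤ A` and
`0 ≤ b ≤ b₀`: these are the mean value bounds for `1 - e^(-y)` and for `u^n / (1 + u^n)` in
logarithmic coordinates. On the clock `∫ a` the damping is `1`, the delay is at most `H = A h₀` and
the delayed coefficient is at most `q = b₀ / a₀`.

Let `|y| ≤ L` eventually, and suppose `y` is positive after a zero. Variation of constants with
`y(h) ≥ -L` bounds `y` at first. The same estimate applied before the zero bounds `-y(h)` by less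
than `L` there, and this improves the bound on `y` at later times. Switching from one to the other
at the best moment gives `y ≤ ρ L` with `ρ = 1 - q e^(-H) + q² ln ((q² + q) / (q² + 1))`. The
stability inequality says exactly that `ρ < 1`, so iterating gives `y → 0`. A solution `y` without
zeros decays because the delayed term then has the sign of `y`.
-/

namespace MackeyGlass

theorem exists_last_eq {X Y : Type*} [ConditionallyCompleteLinearOrder X] [DenselyOrdered X]
    [TopologicalSpace X] [OrderTopology X] [LinearOrder Y] [TopologicalSpace Y]
    [OrderClosedTopology Y] {f : X → Y} {a b : X} {m : Y} (hab : a ≤ b)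
    (hf : ContinuousOn f (Icc a b)) (ha : f a ≤ m) (hb : m < f b) :
    ∃ c ∈ Ico a b, f c = m ∧ ∀ t ∈ Ioc c b, m < f t := by
  have hcompact : IsCompact (Icc a b ∩ f ⁻¹' Iic m) :=
    isCompact_Icc.of_isClosed_subset (hf.preimage_isClosed_of_isClosed isClosed_Icc isClosed_Iic)
      inter_subset_left
  obtain ⟨c, ⟨⟨hac, hcb⟩, hcm⟩, hlast⟩ :=
    hcompact.exists_isGreatest ⟨a, left_mem_Icc.2 hab, ha⟩
  obtain ⟨d, ⟨hcd, hdb⟩, hd⟩ :=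
    intermediate_value_Icc hcb (hf.mono (Icc_subset_Icc_left hac)) ⟨hcm, hb.le⟩
  have hdc : d = c := (hlast ⟨⟨hac.trans hcd, hdb⟩, hd.le⟩).antisymm hcd
  subst hdc
  refine ⟨d, ⟨hac, hcb.lt_of_ne ?_⟩, hd, fun t ht => not_le.1 fun hle =>
    (hlast ⟨⟨hac.trans ht.1.le, ht.2⟩, hle⟩).not_gt ht.1⟩
  rintro rfl
  exact hb.ne' hd

theorem absolutelyContinuousOnInterval_comp_lipschitzOnWith {X Y : Type*} [PseudoMetricSpace X]
    [PseudoMetricSpace Y] {F : ℝ → X} {g : X → Y} {L : NNReal} {a b : ℝ}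
    (hg : LipschitzOnWith L g (F '' uIcc a b)) (hF : AbsolutelyContinuousOnInterval F a b) :
    AbsolutelyContinuousOnInterval (fun t => g (F t)) a b := by
  rw [AbsolutelyContinuousOnInterval] at hF ⊢
  refine squeeze_zero' (Eventually.of_forall fun _ => Finset.sum_nonneg fun _ _ => dist_nonneg) ?_
    (by simpa only [mul_zero] using hF.const_mul (L : ℝ))
  rw [AbsolutelyContinuousOnInterval.totalLengthFilter]
  filter_upwards [mem_inf_of_right (mem_principal_self _)] with E hE
  rw [Finset.mul_sum]
  exact Finset.sum_le_sum fun i hi => hg.dist_le_mul _ (mem_image_of_mem F (hE.1 i hi).1) _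
    (mem_image_of_mem F (hE.1 i hi).2)

theorem absolutelyContinuousOnInterval_comp_contDiff {F g : ℝ → ℝ} {a b : ℝ}
    (hF : AbsolutelyContinuousOnInterval F a b) (hg : ∀ t ∈ uIcc a b, ContDiffAt ℝ 1 g (F t)) :
    AbsolutelyContinuousOnInterval (fun t => g (F t)) a b := by
  have hconvex : Convex ℝ (F '' uIcc a b) :=
    (isPreconnected_uIcc.image F hF.continuousOn).ordConnected.convex
  have hcontDiff : ContDiffOn ℝ 1 g (F '' uIcc a b) := by
    rintro _ ⟨t, ht, rfl⟩
    exact (hg t ht).contDiffWithinAt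
  obtain ⟨L, hL⟩ := hcontDiff.exists_lipschitzOnWith one_ne_zero hconvex
    (isCompact_uIcc.image_of_continuousOn hF.continuousOn)
  exact absolutelyContinuousOnInterval_comp_lipschitzOnWith hL hF

section AbsolutelyContinuous

variable {f g F : ℝ → ℝ} {a b m δ T : ℝ}

theorem mul_sub_le_sub_of_ae_le_deriv (hab : a ≤ b) (hF : AbsolutelyContinuousOnInterval F a b)
    (hd : ∀ᵐ t, t ∈ Ioo a b → δ ≤ deriv F t) : δ * (b - a) ≤ F b - F a := by
  rw [← hF.integral_deriv_eq_sub]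
  calc δ * (b - a) = ∫ _ in a..b, δ := by simp [mul_comm]
    _ ≤ ∫ t in a..b, deriv F t := by
      refine intervalIntegral.integral_mono_ae_restrict hab intervalIntegrable_const
        hF.intervalIntegrable_deriv ?_
      rw [EventuallyLE, ae_restrict_congr_set Ioo_ae_eq_Icc.symm,
        ae_restrict_iff' measurableSet_Ioo]
      exact hd

theorem le_of_ae_deriv_nonneg (hab : a ≤ b) (hF : AbsolutelyContinuousOnInterval F a b)
    (hd : ∀ᵐ t, t ∈ Ioo a b → 0 ≤ deriv F t) : F a ≤ F b := by
  simpa using mul_sub_le_sub_of_ae_le_deriv hab hF hd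

theorem le_of_ae_deriv_nonpos (hab : a ≤ b) (hF : AbsolutelyContinuousOnInterval F a b)
    (hd : ∀ᵐ t, t ∈ Ioo a b → deriv F t ≤ 0) : F b ≤ F a := by
  have hneg : -F a ≤ -F b := le_of_ae_deriv_nonneg (F := fun t => -F t) hab hF.fun_neg (by
    filter_upwards [hd] with t ht hmem
    rw [deriv.fun_neg]
    exact neg_nonneg.2 (ht hmem))
  exact neg_le_neg_iff.1 hneg

theorem le_of_ae_deriv_nonneg_of_lt (hab : a ≤ b) (hF : AbsolutelyContinuousOnInterval F a b)
    (ha : m ≤ F a) (hd : ∀ᵐ t, t ∈ Ioo a b → F t < m → 0 ≤ deriv F t) : m ≤ F b := by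
  by_contra! hb
  obtain ⟨c, ⟨hac, hcb⟩, hc, hlt⟩ := exists_last_eq (f := fun t => -F t) (m := -m) hab
    (uIcc_of_le hab ▸ hF.continuousOn.fun_neg) (neg_le_neg ha) (neg_lt_neg hb)
  have hle : F c ≤ F b := le_of_ae_deriv_nonneg hcb.le
    (hF.mono (uIcc_subset_uIcc ⟨by simp [hac, hab], by simp [hcb.le, hab]⟩ right_mem_uIcc)) (by
      filter_upwards [hd] with t ht hmem
      exact ht ⟨hac.trans_lt hmem.1, hmem.2⟩ (neg_lt_neg_iff.1 (hlt t ⟨hmem.1, hmem.2.le⟩)))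
  linarith

/-- Local absolute continuity on the half-line `[T, ∞)`. -/
def LocallyAbsCont (f : ℝ → ℝ) (T : ℝ) : Prop :=
  ∀ ⦃s t⦄, T ≤ s → s ≤ t → AbsolutelyContinuousOnInterval f s t

namespace LocallyAbsCont

theorem mono (hf : LocallyAbsCont f T) {T' : ℝ} (hT : T ≤ T') : LocallyAbsCont f T' :=
  fun _ _ hs => hf (hT.trans hs)

theorem continuousOn (hf : LocallyAbsCont f T) : ContinuousOn f (Ici T) := by
  intro t (ht : T ≤ t)
  have hcont : ContinuousOn f (Icc T (t + 1)) := by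
    simpa only [uIcc_of_le (ht.trans (lt_add_one t).le)] using
      (hf le_rfl (ht.trans (lt_add_one t).le)).continuousOn
  refine (hcont t ⟨ht, (lt_add_one t).le⟩).mono_of_mem_nhdsWithin ?_
  rw [← Ici_inter_Iic]
  exact inter_mem_nhdsWithin _ (Iic_mem_nhds (lt_add_one t))

theorem neg (hf : LocallyAbsCont f T) : LocallyAbsCont (fun t => -f t) T :=
  fun _ _ hs hst => (hf hs hst).fun_neg

theorem sub (hf : LocallyAbsCont f T) (hg : LocallyAbsCont g T) :
    LocallyAbsCont (fun t => f t - g t) T :=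
  fun _ _ hs hst => (hf hs hst).fun_sub (hg hs hst)

theorem mul (hf : LocallyAbsCont f T) (hg : LocallyAbsCont g T) :
    LocallyAbsCont (fun t => f t * g t) T :=
  fun _ _ hs hst => (hf hs hst).fun_mul (hg hs hst)

theorem comp (hf : LocallyAbsCont f T) (hg : ∀ t, T ≤ t → ContDiffAt ℝ 1 g (f t)) :
    LocallyAbsCont (fun t => g (f t)) T :=
  fun _ _ hs hst => absolutelyContinuousOnInterval_comp_contDiff (hf hs hst) fun u hu =>
    hg u (hs.trans (uIcc_of_le hst ▸ hu).1)

end LocallyAbsCont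

theorem eventually_ge_of_ae_le_deriv (hδ : 0 < δ) (hF : LocallyAbsCont F T)
    (hd : ∀ᵐ t, T ≤ t → F t < m → δ ≤ deriv F t) : ∀ᶠ t in atTop, m ≤ F t := by
  obtain ⟨s, hTs, hms⟩ : ∃ s ≥ T, m ≤ F s := by
    by_contra! hlt
    obtain ⟨t, hTt, ht⟩ : ∃ t ≥ T, m - F T ≤ δ * (t - T) :=
      ((eventually_ge_atTop T).and (((tendsto_id.atTop_add tendsto_const_nhds).const_mul_atTop
        hδ).eventually_ge_atTop (m - F T))).exists
    have hgrowth : δ * (t - T) ≤ F t - F T :=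
      mul_sub_le_sub_of_ae_le_deriv hTt (hF le_rfl hTt) (by
        filter_upwards [hd] with u hu hmem
        exact hu hmem.1.le (hlt u hmem.1.le))
    linarith [hlt t hTt]
  filter_upwards [eventually_ge_atTop s] with t ht
  refine le_of_ae_deriv_nonneg_of_lt ht (hF hTs ht) hms ?_
  filter_upwards [hd] with u hu hmem hlt
  exact hδ.le.trans (hu (hTs.trans hmem.1.le) hlt)

theorem eventually_le_of_ae_deriv_le (hδ : 0 < δ) (hF : LocallyAbsCont F T)
    (hd : ∀ᵐ t, T ≤ t → m < F t → deriv F t ≤ -δ) : ∀ᶠ t in atTop, F t ≤ m := by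
  have hneg : ∀ᶠ t in atTop, -m ≤ -F t := eventually_ge_of_ae_le_deriv hδ hF.neg (by
    filter_upwards [hd] with t ht hTt hlt
    rw [deriv.fun_neg]
    exact le_neg_of_le_neg (ht hTt (neg_lt_neg_iff.1 hlt)))
  exact hneg.mono fun _ => neg_le_neg_iff.1

end AbsolutelyContinuous

section Primitive

variable {a : ℝ → ℝ} {T s t : ℝ}

theorem intervalIntegrable_of_locallyIntegrableOn_Ici (ha : LocallyIntegrableOn a (Ici T))
    (hs : T ≤ s) (ht : T ≤ t) : IntervalIntegrable a volume s t :=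
  (ha.integrableOn_compact_subset (fun _ hu => (le_min hs ht).trans hu.1)
    isCompact_uIcc).intervalIntegrable

theorem locallyAbsCont_integral (ha : LocallyIntegrableOn a (Ici T)) (hs : T ≤ s) :
    LocallyAbsCont (fun t => ∫ u in s..t, a u) s := fun u v hu huv =>
  ((intervalIntegrable_of_locallyIntegrableOn_Ici ha hs
    (hs.trans (hu.trans huv))).absolutelyContinuousOnInterval_intervalIntegral left_mem_uIcc).mono
      (by rw [uIcc_of_le huv, uIcc_of_le (hu.trans huv)]; exact Icc_subset_Icc_left hu)

theorem ae_hasDerivAt_integral (ha : LocallyIntegrableOn a (Ici T)) (hs : T ≤ s) :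
    ∀ᵐ t, s ≤ t → HasDerivAt (fun t => ∫ u in s..t, a u) (a t) t := by
  have hae : ∀ᵐ t, ∀ N : ℕ, t ∈ uIcc s (s + N) →
      HasDerivAt (fun t => ∫ u in s..t, a u) (a t) t := ae_all_iff.2 fun N =>
    (intervalIntegrable_of_locallyIntegrableOn_Ici ha hs
      (le_add_of_le_of_nonneg hs N.cast_nonneg)).ae_hasDerivAt_integral.mono
      fun t ht hmem => ht hmem s left_mem_uIcc
  filter_upwards [hae] with t ht hst
  obtain ⟨N, hN⟩ := exists_nat_ge (t - s)
  exact ht N (by rw [uIcc_of_le (by simp)]; exact ⟨hst, by linarith⟩)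

end Primitive

section ContractionFactor

variable {q H p : ℝ}

/-- The factor by which the amplitude of an oscillating solution of `y' = -a y - b y(h)` shrinks
between consecutive sign changes, when `0 ≤ b ≤ q a` and the delay, measured in units of `∫ a`,
is at most `H`. -/
noncomputable def contractionFactor (q H : ℝ) : ℝ :=
  1 - q * Real.exp (-H) + q ^ 2 * Real.log ((q ^ 2 + q) / (q ^ 2 + 1))

/-- The time after a zero, in units of `∫ a`, at which the bound coming from the amplitude of the
solution is superseded by the bound coming from its values before the zero. -/
noncomputable def switchTime (q H : ℝ) : ℝ := H - Real.log (1 + 1 / q)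

theorem contractionFactor_lt_one_iff (hq : 0 < q) :
    contractionFactor q H < 1 ↔
      Real.log ((q ^ 2 + q) / (q ^ 2 + 1)) < 1 / q * Real.exp (-H) := by
  have hfactor : contractionFactor q H =
      1 - q * (Real.exp (-H) - Real.log ((q ^ 2 + q) / (q ^ 2 + 1)) * q) := by
    rw [contractionFactor]
    ring
  rw [hfactor, sub_lt_self_iff, mul_pos_iff_of_pos_left hq, sub_pos, one_div_mul_eq_div,
    lt_div_iff₀ hq]

theorem exp_mul_contractionFactor_sub_one (q H : ℝ) :
    Real.exp H * (contractionFactor q H - 1) =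
      q ^ 2 * Real.exp H * Real.log ((q ^ 2 + q) / (q ^ 2 + 1)) - q := by
  have hexp : Real.exp H * Real.exp (-H) = 1 := by
    rw [← Real.exp_add, add_neg_cancel, Real.exp_zero]
  rw [contractionFactor]
  linear_combination -q * hexp

theorem switchTime_nonneg (hq : 0 < q) (hH : 1 + 1 / q ≤ Real.exp H) : 0 ≤ switchTime q H :=
  sub_nonneg.2 ((Real.log_le_iff_le_exp (by positivity)).2 hH)

theorem exp_switchTime_mul (hq : 0 < q) (H : ℝ) :
    Real.exp (switchTime q H) * (q + 1) = q * Real.exp H := by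
  rw [switchTime, Real.exp_sub, Real.exp_log (by positivity)]
  field_simp

-- The tangent line to `exp` at `switchTime q H + log ((q² + q) / (q² + 1))`.
theorem mul_one_add_sub_le_mul_exp (hq : 0 < q) (H p : ℝ) :
    q ^ 2 * Real.exp H * (1 + p - switchTime q H - Real.log ((q ^ 2 + q) / (q ^ 2 + 1))) ≤
      (1 + q ^ 2) * Real.exp p := by
  set τ := switchTime q H
  set ℓ := Real.log ((q ^ 2 + q) / (q ^ 2 + 1)) with hℓ
  have hexp : Real.exp (τ + ℓ) * (1 + q ^ 2) = q ^ 2 * Real.exp H := by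
    rw [Real.exp_add, hℓ, Real.exp_log (by positivity)]
    field_simp
    linear_combination (1 + q ^ 2) * exp_switchTime_mul hq H
  calc q ^ 2 * Real.exp H * (1 + p - τ - ℓ) = q ^ 2 * Real.exp H * (p - (τ + ℓ) + 1) := by ring
    _ ≤ q ^ 2 * Real.exp H * Real.exp (p - (τ + ℓ)) := by gcongr; exact Real.add_one_le_exp _
    _ = (1 + q ^ 2) * (Real.exp (τ + ℓ) * Real.exp (p - (τ + ℓ))) := by rw [← hexp]; ring
    _ = (1 + q ^ 2) * Real.exp p := by rw [← Real.exp_add, add_sub_cancel]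

theorem late_envelope_le (hq : 0 < q) (H p : ℝ) :
    q * (Real.exp (switchTime q H) - 1) + q ^ 2 * (Real.exp H * (p - switchTime q H) -
      (Real.exp p - Real.exp (switchTime q H))) ≤
      Real.exp p + Real.exp H * (contractionFactor q H - 1) := by
  rw [exp_mul_contractionFactor_sub_one]
  linarith [mul_one_add_sub_le_mul_exp hq H p, congrArg (q * ·) (exp_switchTime_mul hq H)]

theorem early_envelope_le (hq : 1 ≤ q) (hp : p ≤ switchTime q H) :
    q * (Real.exp p - 1) ≤ Real.exp p + Real.exp H * (contractionFactor q H - 1) := by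
  have hlate := late_envelope_le (zero_lt_one.trans_le hq) H (switchTime q H)
  have hmono := mul_le_mul_of_nonneg_left (Real.exp_le_exp.2 hp) (sub_nonneg.2 hq)
  linarith

theorem contractionFactor_pos (hq : 0 < q) (hH : 1 + 1 / q ≤ Real.exp H) :
    0 < contractionFactor q H := by
  have hlog : (q - 1) / (q ^ 2 + q) ≤ Real.log ((q ^ 2 + q) / (q ^ 2 + 1)) := by
    have harg : 0 < (q ^ 2 + q) / (q ^ 2 + 1) := by positivity
    convert Real.one_sub_inv_le_log_of_pos harg using 1
    field_simp
    ring
  have hexp : Real.exp (-H) ≤ q / (q + 1) := by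
    rw [Real.exp_neg]
    refine (inv_anti₀ (by positivity) hH).trans_eq ?_
    field_simp
  calc 0 < 1 / (q + 1) := by positivity
    _ = 1 - q * (q / (q + 1)) + q ^ 2 * ((q - 1) / (q ^ 2 + q)) := by field_simp; ring
    _ ≤ contractionFactor q H := by rw [contractionFactor]; gcongr

theorem contractionFactor_max_one_lt_one (h : contractionFactor q H < 1) :
    contractionFactor (max q 1) H < 1 := by
  rcases le_total q 1 with hq | hq
  · rw [max_eq_right hq, contractionFactor_lt_one_iff one_pos]
    norm_num [Real.exp_pos]
  · rwa [max_eq_left hq]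

theorem contractionFactor_max_log_lt_one (hq : 0 < q) (h : contractionFactor q H < 1) :
    contractionFactor q (max H (Real.log (1 + 1 / q))) < 1 := by
  rcases le_total (Real.log (1 + 1 / q)) H with hH | hH
  · rwa [max_eq_left hH]
  rw [max_eq_right hH, contractionFactor_lt_one_iff hq, Real.exp_neg,
    Real.exp_log (by positivity)]
  calc Real.log ((q ^ 2 + q) / (q ^ 2 + 1)) ≤ (q ^ 2 + q) / (q ^ 2 + 1) - 1 :=
        Real.log_le_sub_one_of_pos (by positivity)
    _ = (q - 1) / (q ^ 2 + 1) := by field_simp; ring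
    _ < 1 / (q + 1) := by
      rw [div_lt_div_iff₀ (by positivity) (by positivity)]
      linarith
    _ = 1 / q * (1 + 1 / q)⁻¹ := by field_simp

end ContractionFactor

section DelayEquation

/-- The time elapsed between `s` and `t` on a clock running at rate `a`. -/
noncomputable def elapsed (a : ℝ → ℝ) (s t : ℝ) : ℝ := ∫ u in s..t, a u

theorem elapsed_self (a : ℝ → ℝ) (s : ℝ) : elapsed a s s = 0 :=
  intervalIntegral.integral_same

theorem elapsed_le_mul {a : ℝ → ℝ} {T A s t : ℝ} (ha : LocallyIntegrableOn a (Ici T))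
    (hA : ∀ t, T ≤ t → a t ≤ A) (hs : T ≤ s) (hst : s ≤ t) : elapsed a s t ≤ A * (t - s) :=
  calc elapsed a s t ≤ ∫ _ in s..t, A :=
        intervalIntegral.integral_mono_on hst
          (intervalIntegrable_of_locallyIntegrableOn_Ici ha hs (hs.trans hst))
          intervalIntegrable_const fun u hu => hA u (hs.trans hu.1)
    _ = A * (t - s) := by rw [intervalIntegral.integral_const, smul_eq_mul, mul_comm]

/-- `y` solves `y' = -a y - b y(h)` almost everywhere on `[T, ∞)`, where `a ≥ a₀ > 0`,
`0 ≤ b ≤ q a`, and the delay is at most `h₀` in ordinary time and at most `H` on the clock running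
at rate `a`. The clock bound starts at `T + h₀`, since `h` may take values below `T` before. -/
structure IsDelaySolution (T h₀ a₀ q H : ℝ) (a b h y : ℝ → ℝ) : Prop where
  absCont : LocallyAbsCont y T
  deriv_eq : ∀ᵐ t, T ≤ t → HasDerivAt y (-(a t * y t) - b t * y (h t)) t
  locallyIntegrable : LocallyIntegrableOn a (Ici T)
  rate_pos : 0 < a₀
  rate_ge : ∀ t, T ≤ t → a₀ ≤ a t
  coeff_nonneg : ∀ t, T ≤ t → 0 ≤ b t
  coeff_le : ∀ t, T ≤ t → b t ≤ q * a t
  delay_ge : ∀ t, T ≤ t → t - h₀ ≤ h t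
  delay_le : ∀ t, T ≤ t → h t ≤ t
  elapsed_le : ∀ t, T + h₀ ≤ t → elapsed a (h t) t ≤ H

namespace IsDelaySolution

variable {T h₀ a₀ q H L : ℝ} {a b h y : ℝ → ℝ}

theorem of_bounds {A b₀ : ℝ} (hy : LocallyAbsCont y T)
    (hderiv : ∀ᵐ t, T ≤ t → HasDerivAt y (-(a t * y t) - b t * y (h t)) t)
    (ha_int : LocallyIntegrableOn a (Ici T)) (ha₀ : 0 < a₀)
    (ha : ∀ t, T ≤ t → a t ∈ Icc a₀ A) (hb : ∀ t, T ≤ t → b t ∈ Icc 0 b₀)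
    (hh : ∀ t, T ≤ t → h t ≤ t ∧ t - h t ≤ h₀) :
    IsDelaySolution T h₀ a₀ (b₀ / a₀) (A * h₀) a b h y where
  absCont := hy
  deriv_eq := hderiv
  locallyIntegrable := ha_int
  rate_pos := ha₀
  rate_ge t ht := (ha t ht).1
  coeff_nonneg t ht := (hb t ht).1
  coeff_le t ht := by
    calc b t ≤ b₀ := (hb t ht).2
      _ = b₀ / a₀ * a₀ := (div_mul_cancel₀ _ ha₀.ne').symm
      _ ≤ b₀ / a₀ * a t := mul_le_mul_of_nonneg_left (ha t ht).1
          (div_nonneg ((hb t ht).1.trans (hb t ht).2) ha₀.le)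
  delay_ge t ht := sub_le_comm.1 (hh t ht).2
  delay_le t ht := (hh t ht).1
  elapsed_le t ht := by
    have hh₀ : 0 ≤ h₀ := by linarith [hh T le_rfl]
    obtain ⟨hle, hdelay⟩ := hh t (by linarith)
    have hA : 0 ≤ A := (ha₀.le.trans (ha T le_rfl).1).trans (ha T le_rfl).2
    exact (elapsed_le_mul ha_int (fun u hu => (ha u hu).2) (by linarith) hle).trans
      (mul_le_mul_of_nonneg_left hdelay hA)

theorem neg (S : IsDelaySolution T h₀ a₀ q H a b h y) :
    IsDelaySolution T h₀ a₀ q H a b h (fun t => -y t) where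
  __ := S
  absCont := S.absCont.neg
  deriv_eq := by
    filter_upwards [S.deriv_eq] with t ht hT
    exact (ht hT).fun_neg.congr_deriv (by ring)

theorem mono_start (S : IsDelaySolution T h₀ a₀ q H a b h y) {T' : ℝ} (hT : T ≤ T') :
    IsDelaySolution T' h₀ a₀ q H a b h y where
  absCont := S.absCont.mono hT
  deriv_eq := S.deriv_eq.mono fun _ ht h => ht (hT.trans h)
  locallyIntegrable := S.locallyIntegrable.mono_set (Ici_subset_Ici.2 hT)
  rate_pos := S.rate_pos
  rate_ge t ht := S.rate_ge t (hT.trans ht)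
  coeff_nonneg t ht := S.coeff_nonneg t (hT.trans ht)
  coeff_le t ht := S.coeff_le t (hT.trans ht)
  delay_ge t ht := S.delay_ge t (hT.trans ht)
  delay_le t ht := S.delay_le t (hT.trans ht)
  elapsed_le t ht := S.elapsed_le t ((add_le_add_left hT h₀).trans ht)

theorem rate_pos_at (S : IsDelaySolution T h₀ a₀ q H a b h y) {t : ℝ} (ht : T ≤ t) : 0 < a t :=
  S.rate_pos.trans_le (S.rate_ge t ht)

theorem mono_bounds (S : IsDelaySolution T h₀ a₀ q H a b h y) {q' H' : ℝ} (hq : q ≤ q')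
    (hH : H ≤ H') : IsDelaySolution T h₀ a₀ q' H' a b h y where
  __ := S
  coeff_le t ht :=
    (S.coeff_le t ht).trans (mul_le_mul_of_nonneg_right hq (S.rate_pos_at ht).le)
  elapsed_le t ht := (S.elapsed_le t ht).trans hH

theorem ratio_nonneg (S : IsDelaySolution T h₀ a₀ q H a b h y) : 0 ≤ q :=
  nonneg_of_mul_nonneg_left ((S.coeff_nonneg T le_rfl).trans (S.coeff_le T le_rfl))
    (S.rate_pos_at le_rfl)

theorem delay_nonneg (S : IsDelaySolution T h₀ a₀ q H a b h y) : 0 ≤ h₀ := by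
  linarith [S.delay_ge T le_rfl, S.delay_le T le_rfl]

theorem le_delay (S : IsDelaySolution T h₀ a₀ q H a b h y) {s u : ℝ} (hs : T ≤ s)
    (hu : s + h₀ ≤ u) : s ≤ h u := by
  linarith [S.delay_ge u (by linarith [S.delay_nonneg])]

theorem elapsed_add (S : IsDelaySolution T h₀ a₀ q H a b h y) {s t u : ℝ} (hs : T ≤ s)
    (ht : T ≤ t) (hu : T ≤ u) : elapsed a s t + elapsed a t u = elapsed a s u :=
  intervalIntegral.integral_add_adjacent_intervals
    (intervalIntegrable_of_locallyIntegrableOn_Ici S.locallyIntegrable hs ht)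
    (intervalIntegrable_of_locallyIntegrableOn_Ici S.locallyIntegrable ht hu)

theorem elapsed_nonneg (S : IsDelaySolution T h₀ a₀ q H a b h y) {s t : ℝ} (hs : T ≤ s)
    (hst : s ≤ t) : 0 ≤ elapsed a s t :=
  intervalIntegral.integral_nonneg hst fun _ hu => (S.rate_pos_at (hs.trans hu.1)).le

theorem elapsed_pos (S : IsDelaySolution T h₀ a₀ q H a b h y) {s t : ℝ} (hs : T ≤ s)
    (hst : s < t) : 0 < elapsed a s t :=
  intervalIntegral.intervalIntegral_pos_of_pos_on
    (intervalIntegrable_of_locallyIntegrableOn_Ici S.locallyIntegrable hs (hs.trans hst.le))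
    (fun _ hu => S.rate_pos_at (hs.trans hu.1.le)) hst

theorem le_delay_of_lt_elapsed (S : IsDelaySolution T h₀ a₀ q H a b h y) {s u : ℝ} (hs : T ≤ s)
    (hu : T + h₀ ≤ u) (hH : H < elapsed a s u) : s ≤ h u := by
  by_contra! hlt
  have hTh : T ≤ h u := S.le_delay le_rfl hu
  linarith [S.elapsed_le u hu, S.elapsed_pos hTh hlt,
    S.elapsed_add hTh hs (hTh.trans (S.delay_le u (by linarith [S.delay_nonneg])))]

theorem exists_elapsed_eq (S : IsDelaySolution T h₀ a₀ q H a b h y) {s t p : ℝ} (hs : T ≤ s)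
    (hst : s ≤ t) (hp₀ : 0 ≤ p) (hp : p ≤ elapsed a s t) : ∃ u ∈ Icc s t, elapsed a s u = p :=
  intermediate_value_Icc hst
    ((locallyAbsCont_integral S.locallyIntegrable hs).continuousOn.mono Icc_subset_Ici_self)
    ⟨(elapsed_self a s).trans_le hp₀, hp⟩

-- Variation of constants: `(e^p y)' = -e^p b y(h)` on the clock `p`.
theorem exp_mul_sub_le (S : IsDelaySolution T h₀ a₀ q H a b h y) {t₀ s t : ℝ} (ht₀ : T ≤ t₀)
    (hs : t₀ ≤ s) (hst : s ≤ t) {W : ℝ → ℝ} (hW : ContDiff ℝ 1 W)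
    (hle : ∀ u ∈ Ioo s t, -(Real.exp (elapsed a t₀ u) * (b u * y (h u))) ≤
      a u * deriv W (elapsed a t₀ u)) :
    Real.exp (elapsed a t₀ t) * y t - W (elapsed a t₀ t) ≤
      Real.exp (elapsed a t₀ s) * y s - W (elapsed a t₀ s) := by
  have hclock : LocallyAbsCont (elapsed a t₀) t₀ := locallyAbsCont_integral S.locallyIntegrable ht₀
  have hdiff : LocallyAbsCont
      (fun u => W (elapsed a t₀ u) - Real.exp (elapsed a t₀ u) * y u) t₀ :=
    (hclock.comp fun _ _ => hW.contDiffAt).sub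
      ((hclock.comp fun _ _ => Real.contDiff_exp.contDiffAt).mul (S.absCont.mono ht₀))
  have hle := le_of_ae_deriv_nonneg hst (hdiff hs hst) (by
    filter_upwards [ae_hasDerivAt_integral S.locallyIntegrable ht₀, S.deriv_eq] with u hp hy hu
    have ht₀u : t₀ ≤ u := hs.trans hu.1.le
    have hp : HasDerivAt (elapsed a t₀) (a u) u := hp ht₀u
    have hWp := (hW.differentiable one_ne_zero (elapsed a t₀ u)).hasDerivAt
    have hderiv : HasDerivAt (fun u => W (elapsed a t₀ u) - Real.exp (elapsed a t₀ u) * y u) _ u :=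
      (hWp.comp u hp).sub (hp.exp.mul (hy (ht₀.trans ht₀u)))
    rw [hderiv.deriv]
    linarith [hle u hu])
  linarith

theorem amplitude_nonneg (hy : ∀ t, T ≤ t → |y t| ≤ L) : 0 ≤ L :=
  (abs_nonneg _).trans (hy T le_rfl)

theorem exp_elapsed_mul_le (S : IsDelaySolution T h₀ a₀ q H a b h y)
    (hy : ∀ t, T ≤ t → |y t| ≤ L) {s t : ℝ} (hs : T + h₀ ≤ s) (hst : s ≤ t) :
    Real.exp (elapsed a s t) * y t ≤ y s + q * L * (Real.exp (elapsed a s t) - 1) := by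
  have hTs : T ≤ s := (le_add_of_nonneg_right S.delay_nonneg).trans hs
  have hle := S.exp_mul_sub_le hTs le_rfl hst (W := fun p => q * L * Real.exp p) (by fun_prop) ?_
  · simp only [elapsed_self, Real.exp_zero] at hle
    linarith
  intro u hu
  have hTu : T ≤ u := hTs.trans hu.1.le
  have hdelayed : -y (h u) ≤ L :=
    (neg_le_abs _).trans (hy _ (S.le_delay le_rfl (hs.trans hu.1.le)))
  rw [(((Real.hasDerivAt_exp _).const_mul (q * L))).deriv]
  calc -(Real.exp (elapsed a s u) * (b u * y (h u)))
      = Real.exp (elapsed a s u) * (b u * -y (h u)) := by ring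
    _ ≤ Real.exp (elapsed a s u) * (q * a u * L) := by
      refine mul_le_mul_of_nonneg_left ?_ (Real.exp_pos _).le
      exact (mul_le_mul_of_nonneg_left hdelayed (S.coeff_nonneg u hTu)).trans
        (mul_le_mul_of_nonneg_right (S.coeff_le u hTu) (amplitude_nonneg hy))
    _ = a u * (q * L * Real.exp (elapsed a s u)) := by ring

theorem exp_elapsed_mul_neg_delayed_le (S : IsDelaySolution T h₀ a₀ q H a b h y)
    (hy : ∀ t, T ≤ t → |y t| ≤ L) {t₀ u : ℝ} (ht₀ : T + 2 * h₀ ≤ t₀) (hu : t₀ ≤ u)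
    (hzero : y t₀ = 0) (hpos : ∀ t ∈ Icc t₀ u, 0 ≤ y t) (hH : elapsed a t₀ u ≤ H) :
    Real.exp (elapsed a t₀ u) * -y (h u) ≤
      q * L * (Real.exp H - Real.exp (elapsed a t₀ u)) := by
  have h0 := S.delay_nonneg
  have hdelay : T + h₀ ≤ h u := S.le_delay (by linarith) (by linarith)
  have hqL : 0 ≤ q * L := mul_nonneg S.ratio_nonneg (amplitude_nonneg hy)
  rcases le_or_gt t₀ (h u) with hlate | hearly
  · have hnonneg : 0 ≤ y (h u) := hpos _ ⟨hlate, S.delay_le u (by linarith)⟩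
    have hle := mul_nonneg hqL (sub_nonneg.2 (Real.exp_le_exp.2 hH))
    linarith [mul_nonneg (Real.exp_pos (elapsed a t₀ u)).le hnonneg]
  · have hback := S.exp_elapsed_mul_le hy hdelay hearly.le
    rw [hzero, mul_zero] at hback
    have hclock : elapsed a (h u) t₀ + elapsed a t₀ u ≤ H :=
      (S.elapsed_add (by linarith) (by linarith) (by linarith)).trans_le
        (S.elapsed_le u (by linarith))
    calc Real.exp (elapsed a t₀ u) * -y (h u)
        ≤ Real.exp (elapsed a t₀ u) * (q * L * (Real.exp (elapsed a (h u) t₀) - 1)) := by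
          gcongr
          linarith
      _ = q * L * (Real.exp (elapsed a (h u) t₀ + elapsed a t₀ u) -
            Real.exp (elapsed a t₀ u)) := by
          rw [Real.exp_add]
          ring
      _ ≤ q * L * (Real.exp H - Real.exp (elapsed a t₀ u)) := by gcongr

theorem exp_elapsed_mul_le_after_zero (S : IsDelaySolution T h₀ a₀ q H a b h y)
    (hy : ∀ t, T ≤ t → |y t| ≤ L) {t₀ s t : ℝ} (ht₀ : T + 2 * h₀ ≤ t₀) (hs : t₀ ≤ s)
    (hst : s ≤ t) (hzero : y t₀ = 0) (hpos : ∀ u ∈ Icc t₀ t, 0 ≤ y u)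
    (hH : elapsed a t₀ t ≤ H) :
    Real.exp (elapsed a t₀ t) * y t ≤ Real.exp (elapsed a t₀ s) * y s +
      q ^ 2 * L * (Real.exp H * (elapsed a t₀ t - elapsed a t₀ s) -
        (Real.exp (elapsed a t₀ t) - Real.exp (elapsed a t₀ s))) := by
  have hTt₀ : T ≤ t₀ := by linarith [S.delay_nonneg]
  have hle := S.exp_mul_sub_le hTt₀ hs hst
    (W := fun p => q ^ 2 * L * (Real.exp H * p - Real.exp p)) (by fun_prop) ?_
  · linarith
  intro u hu
  have ht₀u : t₀ ≤ u := hs.trans hu.1.le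
  have hTu : T ≤ u := hTt₀.trans ht₀u
  have hHu : elapsed a t₀ u ≤ H := by
    linarith [S.elapsed_add hTt₀ hTu (hTu.trans hu.2.le), S.elapsed_nonneg hTu hu.2.le]
  have hdelayed := S.exp_elapsed_mul_neg_delayed_le hy ht₀ ht₀u hzero
    (fun v hv => hpos v ⟨hv.1, hv.2.trans hu.2.le⟩) hHu
  have hderiv : HasDerivAt (fun p => q ^ 2 * L * (Real.exp H * p - Real.exp p))
      (q ^ 2 * L * (Real.exp H - Real.exp (elapsed a t₀ u))) (elapsed a t₀ u) := by
    simpa using (((hasDerivAt_id' (elapsed a t₀ u)).const_mul (Real.exp H)).sub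
      (Real.hasDerivAt_exp _)).const_mul (q ^ 2 * L)
  rw [hderiv.deriv]
  have hqL : 0 ≤ q * L * (Real.exp H - Real.exp (elapsed a t₀ u)) :=
    mul_nonneg (mul_nonneg S.ratio_nonneg (amplitude_nonneg hy))
      (sub_nonneg.2 (Real.exp_le_exp.2 hHu))
  calc -(Real.exp (elapsed a t₀ u) * (b u * y (h u)))
      = b u * (Real.exp (elapsed a t₀ u) * -y (h u)) := by ring
    _ ≤ b u * (q * L * (Real.exp H - Real.exp (elapsed a t₀ u))) :=
      mul_le_mul_of_nonneg_left hdelayed (S.coeff_nonneg u hTu)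
    _ ≤ q * a u * (q * L * (Real.exp H - Real.exp (elapsed a t₀ u))) :=
      mul_le_mul_of_nonneg_right (S.coeff_le u hTu) hqL
    _ = a u * (q ^ 2 * L * (Real.exp H - Real.exp (elapsed a t₀ u))) := by ring

theorem exp_elapsed_mul_le_envelope (S : IsDelaySolution T h₀ a₀ q H a b h y) (hq : 1 ≤ q)
    (hqH : 1 + 1 / q ≤ Real.exp H) (hy : ∀ t, T ≤ t → |y t| ≤ L) {t₀ t : ℝ}
    (ht₀ : T + 2 * h₀ ≤ t₀) (ht : t₀ ≤ t) (hzero : y t₀ = 0) (hpos : ∀ u ∈ Icc t₀ t, 0 ≤ y u)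
    (hH : elapsed a t₀ t ≤ H) :
    Real.exp (elapsed a t₀ t) * y t ≤
      L * (Real.exp (elapsed a t₀ t) + Real.exp H * (contractionFactor q H - 1)) := by
  have hL : 0 ≤ L := amplitude_nonneg hy
  have hq0 : 0 < q := zero_lt_one.trans_le hq
  have h0 := S.delay_nonneg
  have hearly : ∀ s, t₀ ≤ s → Real.exp (elapsed a t₀ s) * y s ≤
      L * (q * (Real.exp (elapsed a t₀ s) - 1)) := fun s hs => by
    linarith [S.exp_elapsed_mul_le hy (by linarith) hs]
  rcases le_total (elapsed a t₀ t) (switchTime q H) with hle | hge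
  · exact (hearly t ht).trans (mul_le_mul_of_nonneg_left (early_envelope_le hq hle) hL)
  obtain ⟨s, hs, hclock⟩ :=
    S.exists_elapsed_eq (by linarith) ht (switchTime_nonneg hq0 hqH) hge
  have hearly := hearly s hs.1
  have hlate := S.exp_elapsed_mul_le_after_zero hy ht₀ hs.1 hs.2 hzero hpos hH
  rw [hclock] at hearly hlate
  linarith [mul_le_mul_of_nonneg_left (late_envelope_le hq0 H (elapsed a t₀ t)) hL]

theorem le_mul_of_elapsed_le (S : IsDelaySolution T h₀ a₀ q H a b h y) (hq : 1 ≤ q)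
    (hqH : 1 + 1 / q ≤ Real.exp H) (hfactor : contractionFactor q H < 1)
    (hy : ∀ t, T ≤ t → |y t| ≤ L) {t₀ t : ℝ} (ht₀ : T + 2 * h₀ ≤ t₀) (ht : t₀ ≤ t)
    (hzero : y t₀ = 0) (hpos : ∀ u ∈ Icc t₀ t, 0 ≤ y u) (hH : elapsed a t₀ t ≤ H) :
    y t ≤ contractionFactor q H * L := by
  have henvelope := S.exp_elapsed_mul_le_envelope hq hqH hy ht₀ ht hzero hpos hH
  have hlate : Real.exp H * (contractionFactor q H - 1) ≤
      Real.exp (elapsed a t₀ t) * (contractionFactor q H - 1) :=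
    mul_le_mul_of_nonpos_right (Real.exp_le_exp.2 hH) (sub_nonpos.2 hfactor.le)
  refine le_of_mul_le_mul_left (henvelope.trans ?_) (Real.exp_pos (elapsed a t₀ t))
  linarith [mul_le_mul_of_nonneg_left hlate (amplitude_nonneg hy)]

theorem le_mul_after_zero (S : IsDelaySolution T h₀ a₀ q H a b h y) (hq : 1 ≤ q)
    (hqH : 1 + 1 / q ≤ Real.exp H) (hfactor : contractionFactor q H < 1)
    (hy : ∀ t, T ≤ t → |y t| ≤ L) {t₀ t : ℝ} (ht₀ : T + 2 * h₀ ≤ t₀) (ht : t₀ ≤ t)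
    (hzero : y t₀ = 0) (hpos : ∀ u ∈ Icc t₀ t, 0 ≤ y u) :
    y t ≤ contractionFactor q H * L := by
  rcases le_total (elapsed a t₀ t) H with hH | hH
  · exact S.le_mul_of_elapsed_le hq hqH hfactor hy ht₀ ht hzero hpos hH
  have h0 := S.delay_nonneg
  have hTt₀ : T ≤ t₀ := by linarith
  have hH0 : 0 ≤ H := Real.one_le_exp_iff.1 ((le_add_of_nonneg_right (by positivity)).trans hqH)
  obtain ⟨s, hs, hclock⟩ := S.exists_elapsed_eq hTt₀ ht hH0 hH
  have hys := S.le_mul_of_elapsed_le hq hqH hfactor hy ht₀ hs.1 hzero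
    (fun u hu => hpos u ⟨hu.1, hu.2.trans hs.2⟩) hclock.le
  -- After one maximal delay `y(h)` is nonnegative as well, so `y` decreases.
  refine (le_of_ae_deriv_nonpos hs.2 (S.absCont (hTt₀.trans hs.1) hs.2) ?_).trans hys
  filter_upwards [S.deriv_eq] with u hu hmem
  have ht₀u : t₀ ≤ u := hs.1.trans hmem.1.le
  have hTu : T ≤ u := hTt₀.trans ht₀u
  have hTs : T ≤ s := hTt₀.trans hs.1
  have hHu : H < elapsed a t₀ u := by
    linarith [S.elapsed_pos hTs hmem.1, S.elapsed_add hTt₀ hTs hTu]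
  have hdelay : t₀ ≤ h u := S.le_delay_of_lt_elapsed hTt₀ (by linarith) hHu
  rw [(hu hTu).deriv]
  linarith [mul_nonneg (S.rate_pos_at hTu).le (hpos u ⟨ht₀u, hmem.2.le⟩),
    mul_nonneg (S.coeff_nonneg u hTu) (hpos _ ⟨hdelay, (S.delay_le u hTu).trans hmem.2.le⟩)]

theorem eventually_le_of_pos (S : IsDelaySolution T h₀ a₀ q H a b h y)
    (hpos : ∀ t, T ≤ t → 0 < y t) {m : ℝ} (hm : 0 < m) : ∀ᶠ t in atTop, y t ≤ m := by
  have h0 := S.delay_nonneg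
  refine eventually_le_of_ae_deriv_le (T := T + h₀) (mul_pos S.rate_pos hm)
    (S.absCont.mono (by linarith)) ?_
  filter_upwards [S.deriv_eq] with t ht hTt hlt
  have hT : T ≤ t := by linarith
  rw [(ht hT).deriv]
  linarith [mul_le_mul (S.rate_ge t hT) hlt.le hm.le (S.rate_pos_at hT).le,
    mul_nonneg (S.coeff_nonneg t hT) (hpos _ (S.le_delay le_rfl hTt)).le]

theorem eventually_le_mul (S : IsDelaySolution T h₀ a₀ q H a b h y) (hq : 1 ≤ q)
    (hqH : 1 + 1 / q ≤ Real.exp H) (hfactor : contractionFactor q H < 1)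
    (hL : 0 < L) (hy : ∀ t, T ≤ t → |y t| ≤ L) :
    ∀ᶠ t in atTop, y t ≤ contractionFactor q H * L := by
  have hρL : 0 < contractionFactor q H * L :=
    mul_pos (contractionFactor_pos (zero_lt_one.trans_le hq) hqH) hL
  have hT : T ≤ T + 2 * h₀ := by linarith [S.delay_nonneg]
  by_cases hpos : ∀ s, T + 2 * h₀ ≤ s → 0 < y s
  · exact (S.mono_start hT).eventually_le_of_pos hpos hρL
  push Not at hpos
  obtain ⟨s, hs, hys⟩ := hpos
  filter_upwards [eventually_ge_atTop s] with t hst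
  rcases le_or_gt (y t) 0 with hyt | hyt
  · exact hyt.trans hρL.le
  obtain ⟨c, hc, hzero, hlast⟩ :=
    exists_last_eq hst (S.absCont.continuousOn.mono fun _ ht => (hT.trans hs).trans ht.1) hys hyt
  refine S.le_mul_after_zero hq hqH hfactor hy (hs.trans hc.1) hc.2.le hzero fun u hu => ?_
  rcases hu.1.eq_or_lt with rfl | hcu
  · exact hzero.ge
  · exact (hlast u ⟨hcu, hu.2⟩).le

theorem eventually_abs_le_mul (S : IsDelaySolution T h₀ a₀ q H a b h y) (hq : 1 ≤ q)
    (hqH : 1 + 1 / q ≤ Real.exp H) (hfactor : contractionFactor q H < 1)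
    (hL : 0 < L) (hy : ∀ᶠ t in atTop, |y t| ≤ L) :
    ∀ᶠ t in atTop, |y t| ≤ contractionFactor q H * L := by
  obtain ⟨T', hT', hy⟩ := ((eventually_ge_atTop T).and (eventually_forall_ge_atTop.2 hy)).exists
  have S' := S.mono_start hT'
  filter_upwards [S'.eventually_le_mul hq hqH hfactor hL hy,
    S'.neg.eventually_le_mul hq hqH hfactor hL fun t ht => (abs_neg (y t)).trans_le (hy t ht)]
    with t hle hneg
  exact abs_le'.2 ⟨hle, hneg⟩

theorem tendsto_zero_of_one_le (S : IsDelaySolution T h₀ a₀ q H a b h y) (hq : 1 ≤ q)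
    (hqH : 1 + 1 / q ≤ Real.exp H) (hfactor : contractionFactor q H < 1)
    (hy : ∀ᶠ t in atTop, |y t| ≤ L) : Tendsto y atTop (𝓝 0) := by
  set ρ := contractionFactor q H
  have hρ : 0 < ρ := contractionFactor_pos (zero_lt_one.trans_le hq) hqH
  have hL : 0 < max L 1 := lt_max_of_lt_right one_pos
  have hiterate : ∀ k : ℕ, ∀ᶠ t in atTop, |y t| ≤ ρ ^ k * max L 1 := fun k => by
    induction k with
    | zero => exact hy.mono fun t ht => by simpa using Or.inl ht
    | succ k ih =>
      rw [pow_succ', mul_assoc]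
      exact S.eventually_abs_le_mul hq hqH hfactor (mul_pos (pow_pos hρ k) hL) ih
  have hlim : Tendsto (fun k : ℕ => ρ ^ k * max L 1) atTop (𝓝 0) := by
    simpa using (tendsto_pow_atTop_nhds_zero_of_lt_one hρ.le hfactor).mul_const (max L 1)
  rw [tendsto_zero_iff_abs_tendsto_zero, (nhds_basis_abs_sub_lt (0 : ℝ)).tendsto_right_iff]
  intro ε hε
  obtain ⟨k, hk⟩ := (hlim.eventually_lt_const hε).exists
  filter_upwards [hiterate k] with t ht
  simpa using ht.trans_lt hk

theorem tendsto_zero (S : IsDelaySolution T h₀ a₀ q H a b h y)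
    (hfactor : contractionFactor q H < 1) (hy : ∀ᶠ t in atTop, |y t| ≤ L) :
    Tendsto y atTop (𝓝 0) := by
  set q' := max q 1
  have hq' : 1 ≤ q' := le_max_right q 1
  have hq'₀ : 0 < q' := zero_lt_one.trans_le hq'
  set H' := max H (Real.log (1 + 1 / q'))
  have hH' : 1 + 1 / q' ≤ Real.exp H' :=
    (Real.log_le_iff_le_exp (by positivity)).1 (le_max_right _ _)
  have hfactor' : contractionFactor q' H' < 1 :=
    contractionFactor_max_log_lt_one hq'₀ (contractionFactor_max_one_lt_one hfactor)
  exact (S.mono_bounds (le_max_left _ _) (le_max_left _ _)).tendsto_zero_of_one_le hq' hH'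
    hfactor' hy

end IsDelaySolution

end DelayEquation

section Slope

variable {f : ℝ → ℝ}

theorem exists_deriv_eq_dslope (hf : Differentiable ℝ f) (a b : ℝ) :
    ∃ c, dslope f a b = deriv f c := by
  have hlt : ∀ {a b}, a < b → ∃ c, slope f a b = deriv f c := fun {a b} hab => by
    obtain ⟨c, -, hc⟩ := exists_deriv_eq_slope' f hab hf.continuous.continuousOn hf.differentiableOn
    exact ⟨c, hc.symm⟩
  rcases lt_trichotomy a b with hab | rfl | hab
  · rw [dslope_of_ne f hab.ne']
    exact hlt hab
  · exact ⟨a, dslope_same f a⟩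
  · rw [dslope_of_ne f hab.ne, slope_comm]
    exact hlt hab

theorem monotone_dslope_of_convexOn (hconvex : ConvexOn ℝ univ f) (hf : Differentiable ℝ f)
    (a : ℝ) : Monotone (dslope f a) := by
  intro u v huv
  rcases eq_or_ne u a with rfl | hu
  · rcases huv.eq_or_lt with rfl | huv
    · exact le_rfl
    · rw [dslope_same, dslope_of_ne f huv.ne']
      exact hconvex.deriv_le_slope (mem_univ _) (mem_univ _) huv (hf _)
  rcases eq_or_ne v a with rfl | hv
  · rw [dslope_same, dslope_of_ne f hu, slope_comm]
    exact hconvex.slope_le_deriv (mem_univ _) (mem_univ _) (huv.lt_of_ne hu) (hf _)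
  rw [dslope_of_ne f hu, dslope_of_ne f hv]
  exact hconvex.slope_mono (mem_univ a) ⟨mem_univ _, hu⟩ ⟨mem_univ _, hv⟩ huv

end Slope

section ExpQuotient

/-- The function `(1 - e^(-v)) / v`, continuously extended by `1` at `v = 0`. -/
noncomputable def expQuotient (v : ℝ) : ℝ := dslope Real.exp 0 (-v)

theorem expQuotient_mul (v : ℝ) : expQuotient v * v = 1 - Real.exp (-v) := by
  have hslope := sub_smul_dslope Real.exp 0 (-v)
  rw [sub_zero, smul_eq_mul, Real.exp_zero] at hslope
  rw [expQuotient]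
  linarith

theorem expQuotient_of_ne_zero {v : ℝ} (hv : v ≠ 0) :
    expQuotient v = (1 - Real.exp (-v)) / v :=
  (eq_div_iff hv).2 (expQuotient_mul v)

theorem antitone_expQuotient : Antitone expQuotient :=
  (monotone_dslope_of_convexOn convexOn_exp Real.differentiable_exp 0).comp_antitone
    fun _ _ => neg_le_neg

theorem expQuotient_pos (v : ℝ) : 0 < expQuotient v := by
  obtain ⟨c, hc⟩ := exists_deriv_eq_dslope Real.differentiable_exp 0 (-v)
  rw [expQuotient, hc, Real.deriv_exp]
  exact Real.exp_pos c

theorem continuous_expQuotient : Continuous expQuotient := by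
  have hdslope : ContinuousOn (dslope Real.exp 0) univ :=
    (continuousOn_dslope univ_mem).2 ⟨Real.continuous_exp.continuousOn, Real.differentiableAt_exp⟩
  exact (continuousOn_univ.1 hdslope).comp continuous_neg

end ExpQuotient

section Hill

variable {n u v : ℝ}

/-- The Hill function `u^n / (1 + u^n)`. -/
noncomputable def hill (n u : ℝ) : ℝ := u ^ n / (1 + u ^ n)

theorem hill_pos (hu : 0 < u) : 0 < hill n u := by
  have := Real.rpow_pos_of_pos hu n
  exact div_pos this (by linarith)

theorem hill_lt_one (hu : 0 ≤ u) : hill n u < 1 := by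
  have := Real.rpow_nonneg hu n
  rw [hill, div_lt_one (by linarith)]
  linarith

theorem strictMonoOn_hill (hn : 0 < n) : StrictMonoOn (hill n) (Ici 0) := by
  intro u hu v _ huv
  have hpow : u ^ n < v ^ n := Real.rpow_lt_rpow hu huv hn
  have hun : 0 ≤ u ^ n := Real.rpow_nonneg hu n
  rw [hill, hill, div_lt_div_iff₀ (by linarith) (by linarith)]
  linarith

theorem hill_eq_sigmoid (hu : 0 < u) : hill n u = Real.sigmoid (n * Real.log u) := by
  have hpow : Real.exp (-(n * Real.log u)) = (u ^ n)⁻¹ := by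
    rw [Real.exp_neg, mul_comm, ← Real.rpow_def_of_pos hu]
  have := Real.rpow_pos_of_pos hu n
  rw [Real.sigmoid, hpow, hill]
  field_simp
  ring

/-- The difference quotient of the Hill function in logarithmic coordinates, between `v` and `w`,
extended by the derivative to the diagonal. -/
noncomputable def hillSlope (n v w : ℝ) : ℝ := dslope (fun s => Real.sigmoid (n * s)) v w

theorem hill_sub_hill (hu : 0 < u) (hv : 0 < v) :
    hill n u - hill n v = hillSlope n (Real.log v) (Real.log u) * Real.log (u / v) := by
  rw [hill_eq_sigmoid hu, hill_eq_sigmoid hv, Real.log_div hu.ne' hv.ne',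
    mul_comm (hillSlope _ _ _)]
  exact (sub_smul_dslope (fun s => Real.sigmoid (n * s)) _ _).symm

theorem hasDerivAt_sigmoid_mul (n s : ℝ) : HasDerivAt (fun s => Real.sigmoid (n * s))
    (n * (Real.sigmoid (n * s) * (1 - Real.sigmoid (n * s)))) s := by
  rw [mul_comm n (_ * _)]
  exact (Real.hasDerivAt_sigmoid (n * s)).comp s (by simpa using (hasDerivAt_id' s).const_mul n)

theorem hillSlope_mem_Icc (hn : 0 ≤ n) (v w : ℝ) : hillSlope n v w ∈ Icc 0 (n / 4) := by
  obtain ⟨c, hc⟩ := exists_deriv_eq_dslope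
    (fun s => (hasDerivAt_sigmoid_mul n s).differentiableAt) v w
  rw [hillSlope, hc, (hasDerivAt_sigmoid_mul n c).deriv]
  set σ := Real.sigmoid (n * c)
  have hσ : 0 ≤ 1 - σ := sub_nonneg.2 (Real.sigmoid_le_one _)
  refine ⟨mul_nonneg hn (mul_nonneg (Real.sigmoid_nonneg _) hσ), ?_⟩
  rw [div_eq_mul_one_div]
  refine mul_le_mul_of_nonneg_left ?_ hn
  linarith [sq_nonneg (σ - 1 / 2)]

end Hill

section Equilibrium

variable {α β n K : ℝ}

theorem delayCoeff_pos {R : ℝ} (hβ : 0 < β) (hn : 0 < n) (hR : 0 < R) : 0 < delayCoeff β n R :=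
  div_pos (mul_pos (mul_pos hβ hn) hR) four_pos

theorem lowerBound_pos (hα : 0 < α) (hβ : 0 < β) : 0 < lowerBound α β := div_pos hα hβ

theorem mul_lowerBound (hβ : 0 < β) : β * lowerBound α β = α := mul_div_cancel₀ α hβ.ne'

theorem upperBound_mul_hill (hα : 0 < α) (hβ : 0 < β) :
    upperBound α β n * hill n (lowerBound α β) = lowerBound α β := by
  have hpow : (β / α) ^ n = ((α / β) ^ n)⁻¹ := by
    rw [← Real.inv_rpow (div_pos hα hβ).le, inv_div]
  have := Real.rpow_pos_of_pos (div_pos hα hβ) n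
  rw [upperBound, hill, lowerBound, hpow]
  field_simp
  ring

namespace IsPositiveEquilibrium

theorem mul_hill (hK : IsPositiveEquilibrium α β n K) : β * K * hill n K = α := by
  obtain ⟨hK₀, heq⟩ := hK
  have := Real.rpow_pos_of_pos hK₀ n
  rw [Real.rpow_add hK₀, Real.rpow_one] at heq
  rw [hill]
  field_simp
  linarith

theorem lowerBound_lt (hK : IsPositiveEquilibrium α β n K) (hβ : 0 < β) :
    lowerBound α β < K := by
  rw [lowerBound, div_lt_iff₀ hβ]
  calc α = β * K * hill n K := hK.mul_hill.symm
    _ < β * K * 1 := mul_lt_mul_of_pos_left (hill_lt_one hK.1.le) (mul_pos hβ hK.1)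
    _ = K * β := by ring

theorem lt_upperBound (hK : IsPositiveEquilibrium α β n K) (hα : 0 < α) (hβ : 0 < β)
    (hn : 0 < n) : K < upperBound α β n := by
  have hμ := lowerBound_pos hα hβ
  refine lt_of_mul_lt_mul_right ?_ (hill_pos (n := n) hμ).le
  calc K * hill n (lowerBound α β) < K * hill n K :=
        mul_lt_mul_of_pos_left (strictMonoOn_hill hn hμ.le hK.1.le (hK.lowerBound_lt hβ)) hK.1
    _ = lowerBound α β := by
        rw [lowerBound, eq_div_iff hβ.ne']
        linarith [hK.mul_hill]
    _ = upperBound α β n * hill n (lowerBound α β) := (upperBound_mul_hill hα hβ).symm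

theorem eventually_log_mem_Icc {x : ℝ → ℝ} (hK : IsPositiveEquilibrium α β n K) (hα : 0 < α)
    (hβ : 0 < β) (hx : ∀ᶠ t in atTop, x t ∈ Icc (lowerBound α β) (upperBound α β n)) :
    ∀ᶠ t in atTop, Real.log (x t / K) ∈ Icc (logLower α β K) (logUpper α β n K) := by
  have hμ := lowerBound_pos hα hβ
  refine hx.mono fun t ht => ⟨?_, ?_⟩
  · exact Real.log_le_log (div_pos hμ hK.1) (div_le_div_of_nonneg_right ht.1 hK.1.le)
  · exact Real.log_le_log (div_pos (hμ.trans_le ht.1) hK.1)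
      (div_le_div_of_nonneg_right ht.2 hK.1.le)

theorem coeffLower_eq (hK : IsPositiveEquilibrium α β n K) (hα : 0 < α) (hβ : 0 < β)
    (hn : 0 < n) (r₀ : ℝ) :
    coeffLower α β n K r₀ = α / K * expQuotient (logUpper α β n K) * r₀ := by
  have hC : 0 < logUpper α β n K :=
    Real.log_pos ((one_lt_div hK.1).2 (hK.lt_upperBound hα hβ hn))
  rw [coeffLower, expQuotient_of_ne_zero hC.ne']

theorem coeffUpper_eq (hK : IsPositiveEquilibrium α β n K) (hα : 0 < α) (hβ : 0 < β) (R : ℝ) :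
    coeffUpper α β K R = α / K * expQuotient (logLower α β K) * R := by
  have hc : logLower α β K < 0 :=
    Real.log_neg (div_pos (lowerBound_pos hα hβ) hK.1) ((div_lt_one hK.1).2 (hK.lowerBound_lt hβ))
  rw [coeffUpper, expQuotient_of_ne_zero hc.ne]

end IsPositiveEquilibrium

theorem StabilityInequality.contractionFactor_lt_one {a₀ A b₀ h₀ : ℝ}
    (h : StabilityInequality a₀ A b₀ h₀) (ha₀ : 0 < a₀) (hb₀ : 0 < b₀) :
    contractionFactor (b₀ / a₀) (A * h₀) < 1 := by
  have hratio : ((b₀ / a₀) ^ 2 + b₀ / a₀) / ((b₀ / a₀) ^ 2 + 1) =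
      (b₀ ^ 2 + a₀ * b₀) / (b₀ ^ 2 + a₀ ^ 2) := by
    field_simp
  rwa [contractionFactor_lt_one_iff (div_pos hb₀ ha₀), one_div_div, hratio]

end Equilibrium

namespace IsSolution

variable {α β n r₀ : ℝ} {r h φ x : ℝ → ℝ}

theorem ae_hasDerivAt (hx : IsSolution α β n r h φ x) :
    ∀ᵐ t, 0 ≤ t → HasDerivAt x (r t * (α - β * x t * hill n (x (h t)))) t := by
  simpa only [hill, mul_div_assoc, mem_Ici] using (ae_restrict_iff' measurableSet_Ici).1 hx.deriv_eq

theorem locallyAbsCont (hx : IsSolution α β n r h φ x) : LocallyAbsCont x 0 := fun s t hs hst =>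
  (hx.absCont t (hs.trans hst)).mono <| by
    rw [uIcc_of_le hst, uIcc_of_le (hs.trans hst)]
    exact Icc_subset_Icc_left hs

theorem pos (hx : IsSolution α β n r h φ x) (hα : 0 < α) (hβ : 0 < β)
    (hr : ∀ t, 0 ≤ t → 0 ≤ r t) (hh : ∀ t, 0 ≤ t → h t ≤ t) (hφ : ∀ t, t ≤ 0 → 0 ≤ φ t)
    (hφ₀ : 0 < φ 0) {t : ℝ} (ht : 0 ≤ t) : 0 < x t := by
  by_contra! hxt
  have hcont : ContinuousOn x (Icc 0 t) := hx.locallyAbsCont.continuousOn.mono Icc_subset_Ici_self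
  have hcompact : IsCompact (Icc 0 t ∩ x ⁻¹' Iic 0) :=
    isCompact_Icc.of_isClosed_subset
      (hcont.preimage_isClosed_of_isClosed isClosed_Icc isClosed_Iic) inter_subset_left
  obtain ⟨c, ⟨⟨hc₀, hct⟩, hxc⟩, hfirst⟩ := hcompact.exists_isLeast ⟨t, ⟨ht, le_rfl⟩, hxt⟩
  have hbefore : ∀ u, u < c → 0 ≤ x u := fun u huc => by
    rcases le_total u 0 with hu | hu
    · exact (hx.initial u hu).symm ▸ hφ u hu
    · exact le_of_not_ge fun hle => (hfirst ⟨⟨hu, huc.le.trans hct⟩, hle⟩).not_gt huc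
  have hm : 0 < min (x 0) (α / β) :=
    lt_min (by rwa [hx.initial 0 le_rfl]) (div_pos hα hβ)
  -- Below `α / β` the production term dominates, so `x` cannot fall further.
  refine (hm.trans_le (le_of_ae_deriv_nonneg_of_lt hc₀ (hx.locallyAbsCont le_rfl hc₀)
    (min_le_left _ _) ?_)).not_ge hxc
  filter_upwards [hx.ae_hasDerivAt] with u hu hmem hlt
  have hxu : x u * β < α := (lt_div_iff₀ hβ).1 (hlt.trans_le (min_le_right _ _))
  rw [(hu hmem.1.le).deriv]
  refine mul_nonneg (hr u hmem.1.le) (sub_nonneg.2 ?_)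
  calc β * x u * hill n (x (h u)) ≤ β * x u * 1 :=
        mul_le_mul_of_nonneg_left
          (hill_lt_one (hbefore _ ((hh u hmem.1.le).trans_lt hmem.2))).le
          (mul_nonneg hβ.le (hbefore u hmem.2))
    _ ≤ α := by linarith

section Dissipativity

variable {f m : ℝ}

theorem eventually_ge (hx : IsSolution α β n r h φ x) (hβ : 0 < β) (hr₀ : 0 < r₀)
    (hr : ∀ t, 0 ≤ t → r₀ ≤ r t) (hpos : ∀ t, 0 ≤ t → 0 < x t) (hf₀ : 0 ≤ f)
    (hf : ∀ᶠ t in atTop, hill n (x (h t)) ≤ f) (hm : β * m * f < α) :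
    ∀ᶠ t in atTop, m ≤ x t := by
  obtain ⟨T, hT, hf⟩ := ((eventually_ge_atTop 0).and (eventually_forall_ge_atTop.2 hf)).exists
  refine eventually_ge_of_ae_le_deriv (mul_pos hr₀ (sub_pos.2 hm)) (hx.locallyAbsCont.mono hT) ?_
  filter_upwards [hx.ae_hasDerivAt] with t ht hTt hlt
  have ht₀ : 0 ≤ t := hT.trans hTt
  have hdecay : β * x t * hill n (x (h t)) ≤ β * m * f :=
    calc β * x t * hill n (x (h t)) ≤ β * x t * f :=
          mul_le_mul_of_nonneg_left (hf t hTt) (mul_pos hβ (hpos t ht₀)).le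
      _ ≤ β * m * f := by gcongr
  rw [(ht ht₀).deriv]
  exact mul_le_mul (hr t ht₀) (sub_le_sub_left hdecay α) (sub_pos.2 hm).le
    (hr₀.le.trans (hr t ht₀))

theorem eventually_le (hx : IsSolution α β n r h φ x) (hβ : 0 < β) (hr₀ : 0 < r₀)
    (hr : ∀ t, 0 ≤ t → r₀ ≤ r t) (hpos : ∀ t, 0 ≤ t → 0 < x t) (hf₀ : 0 ≤ f)
    (hf : ∀ᶠ t in atTop, f ≤ hill n (x (h t))) (hm : α < β * m * f) :
    ∀ᶠ t in atTop, x t ≤ m := by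
  obtain ⟨T, hT, hf⟩ := ((eventually_ge_atTop 0).and (eventually_forall_ge_atTop.2 hf)).exists
  refine eventually_le_of_ae_deriv_le (mul_pos hr₀ (sub_pos.2 hm)) (hx.locallyAbsCont.mono hT) ?_
  filter_upwards [hx.ae_hasDerivAt] with t ht hTt hlt
  have ht₀ : 0 ≤ t := hT.trans hTt
  have hdecay : β * m * f ≤ β * x t * hill n (x (h t)) :=
    calc β * m * f ≤ β * x t * f := by gcongr
      _ ≤ β * x t * hill n (x (h t)) :=
          mul_le_mul_of_nonneg_left (hf t hTt) (mul_pos hβ (hpos t ht₀)).le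
  have hspeed : r₀ * (β * m * f - α) ≤ r t * (β * x t * hill n (x (h t)) - α) :=
    mul_le_mul (hr t ht₀) (sub_le_sub_right hdecay α) (sub_pos.2 hm).le
      (hr₀.le.trans (hr t ht₀))
  rw [(ht ht₀).deriv]
  linarith

theorem exists_eventually_le (hx : IsSolution α β n r h φ x) (hα : 0 < α) (hβ : 0 < β)
    (hn : 0 < n) (hr₀ : 0 < r₀) (hr : ∀ t, 0 ≤ t → r₀ ≤ r t) (hh : Tendsto h atTop atTop)
    (hpos : ∀ t, 0 ≤ t → 0 < x t) : ∃ B, ∀ᶠ t in atTop, x t ≤ B := by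
  have hμ : 0 < lowerBound α β / 2 := half_pos (lowerBound_pos hα hβ)
  have hle_one : ∀ᶠ t in atTop, hill n (x (h t)) ≤ 1 :=
    (hh.eventually_ge_atTop 0).mono fun t ht => (hill_lt_one (hpos _ ht).le).le
  have hge : ∀ᶠ t in atTop, lowerBound α β / 2 ≤ x t :=
    hx.eventually_ge hβ hr₀ hr hpos zero_le_one hle_one (by linarith [mul_lowerBound (α := α) hβ])
  set f := hill n (lowerBound α β / 2)
  have hf : 0 < f := hill_pos hμ
  have hhill : ∀ᶠ t in atTop, f ≤ hill n (x (h t)) :=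
    (hh.eventually hge).mono fun t ht =>
      (strictMonoOn_hill hn).monotoneOn hμ.le (hμ.le.trans ht) ht
  refine ⟨2 * lowerBound α β / f, hx.eventually_le hβ hr₀ hr hpos hf.le hhill ?_⟩
  calc α < 2 * (β * lowerBound α β) := by linarith [mul_lowerBound (α := α) hβ]
    _ = β * (2 * lowerBound α β / f) * f := by field_simp

theorem exists_eventually_ge (hx : IsSolution α β n r h φ x) (hα : 0 < α) (hβ : 0 < β)
    (hn : 0 < n) (hr₀ : 0 < r₀) (hr : ∀ t, 0 ≤ t → r₀ ≤ r t) (hh : Tendsto h atTop atTop)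
    (hpos : ∀ t, 0 ≤ t → 0 < x t) : ∃ m > lowerBound α β, ∀ᶠ t in atTop, m ≤ x t := by
  obtain ⟨B, hB⟩ := hx.exists_eventually_le hα hβ hn hr₀ hr hh hpos
  have hB₀ : 0 < B := by
    obtain ⟨t, ht, hle⟩ := ((eventually_ge_atTop 0).and hB).exists
    exact (hpos t ht).trans_le hle
  have hhill : ∀ᶠ t in atTop, hill n (x (h t)) ≤ hill n B := by
    filter_upwards [hh.eventually_ge_atTop 0, hh.eventually hB] with t ht hle
    exact (strictMonoOn_hill hn).monotoneOn (hpos _ ht).le hB₀.le hle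
  have hf : 0 < hill n B := hill_pos hB₀
  obtain ⟨m, hμm, hm⟩ : ∃ m, lowerBound α β < m ∧ m < lowerBound α β / hill n B :=
    exists_between ((lt_div_iff₀ hf).2
      (mul_lt_of_lt_one_right (lowerBound_pos hα hβ) (hill_lt_one hB₀.le)))
  refine ⟨m, hμm, hx.eventually_ge hβ hr₀ hr hpos hf.le hhill ?_⟩
  calc β * m * hill n B = β * (m * hill n B) := mul_assoc _ _ _
    _ < β * lowerBound α β := mul_lt_mul_of_pos_left ((lt_div_iff₀ hf).1 hm) hβ
    _ = α := mul_lowerBound hβ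

theorem eventually_mem_Icc (hx : IsSolution α β n r h φ x) (hα : 0 < α) (hβ : 0 < β)
    (hn : 0 < n) (hr₀ : 0 < r₀) (hr : ∀ t, 0 ≤ t → r₀ ≤ r t) (hh : Tendsto h atTop atTop)
    (hpos : ∀ t, 0 ≤ t → 0 < x t) :
    ∀ᶠ t in atTop, x t ∈ Icc (lowerBound α β) (upperBound α β n) := by
  have hμ := lowerBound_pos hα hβ
  obtain ⟨m, hμm, hge⟩ := hx.exists_eventually_ge hα hβ hn hr₀ hr hh hpos
  have hm : 0 ≤ m := hμ.le.trans hμm.le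
  have hhill : ∀ᶠ t in atTop, hill n m ≤ hill n (x (h t)) :=
    (hh.eventually hge).mono fun t ht =>
      (strictMonoOn_hill hn).monotoneOn hm (hm.trans ht) ht
  have hM : 0 < upperBound α β n :=
    pos_of_mul_pos_left ((upperBound_mul_hill hα hβ).symm ▸ hμ) (hill_pos hμ).le
  have hle : ∀ᶠ t in atTop, x t ≤ upperBound α β n := by
    refine hx.eventually_le hβ hr₀ hr hpos (hill_pos (hμ.trans hμm)).le hhill ?_
    calc α = β * (upperBound α β n * hill n (lowerBound α β)) := by
          rw [upperBound_mul_hill hα hβ, mul_lowerBound hβ]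
      _ < β * (upperBound α β n * hill n m) := by
          gcongr
          exact strictMonoOn_hill hn hμ.le hm hμm
      _ = β * upperBound α β n * hill n m := (mul_assoc _ _ _).symm
  filter_upwards [hge, hle] with t hmt htM
  exact ⟨hμm.le.trans hmt, htM⟩

end Dissipativity

end IsSolution

section LogLinearization

variable {α β n K c C r₀ R h₀ T t : ℝ} {r h φ x : ℝ → ℝ}

/-- The coefficient `a` in the equation `y' = -a y - b y(h)` satisfied by `y = log (x / K)`. -/
noncomputable def dampingRate (α K : ℝ) (r x : ℝ → ℝ) (t : ℝ) : ℝ :=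
  α / K * expQuotient (Real.log (x t / K)) * r t

/-- The coefficient `b` in the equation `y' = -a y - b y(h)` satisfied by `y = log (x / K)`. -/
noncomputable def delayRate (β n K : ℝ) (r h x : ℝ → ℝ) (t : ℝ) : ℝ :=
  β * r t * hillSlope n (Real.log K) (Real.log (x (h t)))

theorem hasDerivAt_log_div (hK : IsPositiveEquilibrium α β n K) (hxt : 0 < x t)
    (hxh : 0 < x (h t)) (hx : HasDerivAt x (r t * (α - β * x t * hill n (x (h t)))) t) :
    HasDerivAt (fun t => Real.log (x t / K)) (-(dampingRate α K r x t * Real.log (x t / K)) -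
      delayRate β n K r h x t * Real.log (x (h t) / K)) t := by
  have hK₀ := hK.1
  refine ((hx.div_const K).log (div_pos hxt hK₀).ne').congr_deriv ?_
  have hdamping : expQuotient (Real.log (x t / K)) * Real.log (x t / K) = 1 - K / x t := by
    rw [expQuotient_mul, Real.exp_neg, Real.exp_log (div_pos hxt hK₀), inv_div]
  have hdelay := hill_sub_hill (n := n) hxh hK₀
  have hα : α / K = β * hill n K := by
    rw [div_eq_iff hK₀.ne']
    linarith [hK.mul_hill]
  calc r t * (α - β * x t * hill n (x (h t))) / K / (x t / K)
      = -(α / K * (1 - K / x t) * r t) - β * r t * (hill n (x (h t)) - hill n K) := by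
        rw [hα, ← hK.mul_hill]
        field_simp
        ring
    _ = _ := by
        rw [← hdamping, hdelay, dampingRate, delayRate]
        ring

theorem dampingRate_mem_Icc (hαK : 0 ≤ α / K) (hr₀ : 0 ≤ r₀) (hr : r t ∈ Icc r₀ R)
    (hlog : Real.log (x t / K) ∈ Icc c C) :
    dampingRate α K r x t ∈ Icc (α / K * expQuotient C * r₀) (α / K * expQuotient c * R) :=
  ⟨mul_le_mul (mul_le_mul_of_nonneg_left (antitone_expQuotient hlog.2) hαK) hr.1 hr₀
      (mul_nonneg hαK (expQuotient_pos _).le),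
    mul_le_mul (mul_le_mul_of_nonneg_left (antitone_expQuotient hlog.1) hαK) hr.2
      (hr₀.trans hr.1) (mul_nonneg hαK (expQuotient_pos _).le)⟩

theorem delayRate_mem_Icc (hβ : 0 ≤ β) (hn : 0 ≤ n) (hr : r t ∈ Icc 0 R) :
    delayRate β n K r h x t ∈ Icc 0 (delayCoeff β n R) := by
  obtain ⟨hslope₀, hslope⟩ := hillSlope_mem_Icc hn (Real.log K) (Real.log (x (h t)))
  have hr₀ := hr.1
  refine ⟨mul_nonneg (mul_nonneg hβ hr₀) hslope₀, ?_⟩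
  calc delayRate β n K r h x t ≤ β * R * (n / 4) := by
        rw [delayRate]
        gcongr
        exacts [mul_nonneg hβ (hr₀.trans hr.2), hr.2]
    _ = delayCoeff β n R := by
        rw [delayCoeff]
        ring

theorem locallyIntegrableOn_dampingRate (hr : LocallyIntegrableOn r (Ici T))
    (hx : ContinuousOn x (Ici T)) (hK : 0 < K) (hpos : ∀ t, T ≤ t → 0 < x t) :
    LocallyIntegrableOn (dampingRate α K r x) (Ici T) := by
  have hlog : ContinuousOn (fun t => Real.log (x t / K)) (Ici T) :=
    (hx.div_const K).log fun t ht => (div_pos (hpos t ht) hK).ne'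
  exact hr.continuousOn_mul
    (continuousOn_const.mul (continuous_expQuotient.comp_continuousOn hlog))
    isClosed_Ici.isLocallyClosed

theorem IsSolution.isDelaySolution_log (hx : IsSolution α β n r h φ x) (hα : 0 < α) (hβ : 0 < β)
    (hn : 0 < n) (hK : IsPositiveEquilibrium α β n K)
    (hr_int : LocallyIntegrableOn r (Ici 0)) (hr₀ : 0 < r₀)
    (hr : ∀ t, 0 ≤ t → r₀ ≤ r t ∧ r t ≤ R) (hh : ∀ t, 0 ≤ t → h t ≤ t ∧ t - h t ≤ h₀)
    (hpos : ∀ t, 0 ≤ t → 0 < x t) (hT : h₀ ≤ T)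
    (hlog : ∀ t, T ≤ t → Real.log (x t / K) ∈ Icc c C) :
    IsDelaySolution T h₀ (α / K * expQuotient C * r₀)
      (delayCoeff β n R / (α / K * expQuotient C * r₀)) (α / K * expQuotient c * R * h₀)
      (dampingRate α K r x) (delayRate β n K r h x) h (fun t => Real.log (x t / K)) := by
  have hK₀ := hK.1
  have hαK : 0 < α / K := div_pos hα hK₀
  have hh₀ : 0 ≤ h₀ := by linarith [hh 0 le_rfl]
  have hT₀ : 0 ≤ T := hh₀.trans hT
  refine .of_bounds
    ((hx.locallyAbsCont.mono hT₀).comp (g := fun u => Real.log (u / K)) fun t ht =>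
      (contDiff_id.div_const K).contDiffAt.log (div_pos (hpos t (hT₀.trans ht)) hK₀).ne')
    ?_
    (locallyIntegrableOn_dampingRate (hr_int.mono_set (Ici_subset_Ici.2 hT₀))
      (hx.locallyAbsCont.mono hT₀).continuousOn hK₀ fun t ht => hpos t (hT₀.trans ht))
    (mul_pos (mul_pos hαK (expQuotient_pos C)) hr₀)
    (fun t ht => dampingRate_mem_Icc hαK.le hr₀.le (hr t (hT₀.trans ht)) (hlog t ht))
    (fun t ht => delayRate_mem_Icc hβ.le hn.le ⟨hr₀.le.trans (hr t (hT₀.trans ht)).1,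
      (hr t (hT₀.trans ht)).2⟩)
    (fun t ht => hh t (hT₀.trans ht))
  filter_upwards [hx.ae_hasDerivAt] with t ht hTt
  have ht₀ : 0 ≤ t := hT₀.trans hTt
  exact hasDerivAt_log_div hK (hpos t ht₀) (hpos _ (by linarith [hh t ht₀])) (ht ht₀)

end LogLinearization

theorem tendsto_atTop_of_sub_le {h : ℝ → ℝ} {T h₀ : ℝ} (hh : ∀ t, T ≤ t → t - h t ≤ h₀) :
    Tendsto h atTop atTop := by
  refine tendsto_atTop_mono' atTop ?_ (tendsto_atTop_add_const_right atTop (-h₀) tendsto_id)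
  filter_upwards [eventually_ge_atTop T] with t ht
  exact (sub_eq_add_neg t h₀).symm.trans_le (sub_le_comm.1 (hh t ht))

theorem locallyIntegrableOn_of_mem_Icc {X : Type*} [TopologicalSpace X] [MeasurableSpace X]
    [OpensMeasurableSpace X] {μ : Measure X} [IsLocallyFiniteMeasure μ] {f : X → ℝ} {s : Set X}
    {a b : ℝ} (hs : MeasurableSet s) (hf : AEMeasurable f (μ.restrict s))
    (hbound : ∀ t ∈ s, f t ∈ Icc a b) : LocallyIntegrableOn f s μ := by
  refine locallyIntegrableOn_of_locallyIntegrable_restrict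
    ((locallyIntegrable_const (max |a| |b|)).mono hf.aestronglyMeasurable ?_)
  filter_upwards [ae_restrict_mem hs] with t ht
  exact (abs_le_max_abs_abs (hbound t ht).1 (hbound t ht).2).trans (le_abs_self _)

theorem tendsto_of_tendsto_log_div {ι : Type*} {l : Filter ι} {x : ι → ℝ} {K : ℝ} (hK : 0 < K)
    (hx : ∀ᶠ t in l, 0 < x t) (hlog : Tendsto (fun t => Real.log (x t / K)) l (𝓝 0)) :
    Tendsto x l (𝓝 K) := by
  have hexp : Tendsto (fun t => K * Real.exp (Real.log (x t / K))) l (𝓝 K) := by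
    simpa only [Real.exp_zero, mul_one] using hlog.rexp.const_mul K
  refine hexp.congr' (hx.mono fun t ht => ?_)
  rw [Real.exp_log (div_pos ht hK), mul_div_cancel₀ _ hK.ne']

end MackeyGlass

open MackeyGlass in
theorem theorem7_general (α β n K r₀ R h₀ : ℝ) (r h : ℝ → ℝ)
    (hα : 0 < α) (hβ : 0 < β) (hn : 0 < n) (hK : IsPositiveEquilibrium α β n K)
    (hr_meas : AEMeasurable r (volume.restrict (Ici (0 : ℝ))))
    (hr₀ : 0 < r₀) (hr : ∀ t : ℝ, 0 ≤ t → r₀ ≤ r t ∧ r t ≤ R)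
    (hh : ∀ t : ℝ, 0 ≤ t → h t ≤ t ∧ t - h t ≤ h₀)
    (hineq : StabilityInequality (coeffLower α β n K r₀) (coeffUpper α β K R)
      (delayCoeff β n R) h₀)
    (φ x : ℝ → ℝ) (hφ_nonneg : ∀ t : ℝ, t ≤ 0 → 0 ≤ φ t) (hφ_pos : 0 < φ 0)
    (hx : IsSolution α β n r h φ x) :
    Tendsto x atTop (𝓝 K) := by
  have hK₀ := hK.1
  have hpos : ∀ t, 0 ≤ t → 0 < x t := fun t =>
    hx.pos hα hβ (fun t ht => hr₀.le.trans (hr t ht).1) (fun t ht => (hh t ht).1) hφ_nonneg hφ_pos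
  have hlog := hK.eventually_log_mem_Icc hα hβ
    (hx.eventually_mem_Icc hα hβ hn hr₀ (fun t ht => (hr t ht).1)
      (tendsto_atTop_of_sub_le fun t ht => (hh t ht).2) hpos)
  obtain ⟨T, hT, hlogT⟩ :=
    ((eventually_ge_atTop h₀).and (eventually_forall_ge_atTop.2 hlog)).exists
  have S := hx.isDelaySolution_log hα hβ hn hK
    (locallyIntegrableOn_of_mem_Icc measurableSet_Ici hr_meas hr) hr₀ hr hh hpos hT hlogT
  rw [← hK.coeffLower_eq hα hβ hn, ← hK.coeffUpper_eq hα hβ] at S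
  have hb₀ : 0 < delayCoeff β n R :=
    delayCoeff_pos hβ hn (hr₀.trans_le ((hr 0 le_rfl).1.trans (hr 0 le_rfl).2))
  have hzero : Tendsto (fun t => Real.log (x t / K)) atTop (𝓝 0) :=
    S.tendsto_zero (hineq.contractionFactor_lt_one S.rate_pos hb₀)
      (hlog.mono fun t ht => abs_le_max_abs_abs ht.1 ht.2)
  exact tendsto_of_tendsto_log_div hK₀ (eventually_atTop.2 ⟨0, hpos⟩) hzero

theorem theorem7 (α β n K r₀ R h₀ : ℝ) (r h : ℝ → ℝ)
    (hα : 0 < α) (hβ : 0 < β) (hn : 0 < n)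
    (hK : MackeyGlass.IsPositiveEquilibrium α β n K)
    (hr_meas : AEMeasurable r (volume.restrict (Ici (0 : ℝ))))
    (hr₀ : 0 < r₀) (hr : ∀ t : ℝ, 0 ≤ t → r₀ ≤ r t ∧ r t ≤ R)
    (hh_meas : AEMeasurable h (volume.restrict (Ici (0 : ℝ))))
    (hh : ∀ t : ℝ, 0 ≤ t → h t ≤ t ∧ t - h t ≤ h₀)
    (hineq : MackeyGlass.StabilityInequality
      (MackeyGlass.coeffLower α β n K r₀) (MackeyGlass.coeffUpper α β K R)
      (MackeyGlass.delayCoeff β n R) h₀)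
    (φ x : ℝ → ℝ)
    (hφ_meas : Measurable (fun t : Iic (0 : ℝ) => φ t))
    (hφ_bdd : ∃ B : ℝ, ∀ t : ℝ, t ≤ 0 → |φ t| ≤ B)
    (hφ_nonneg : ∀ t : ℝ, t ≤ 0 → 0 ≤ φ t) (hφ_pos : 0 < φ 0)
    (hx : MackeyGlass.IsSolution α β n r h φ x) :
    Tendsto x atTop (𝓝 K) := by
  exact theorem7_general α β n K r₀ R h₀ r h hα hβ hn hK hr_meas hr₀ hr hh hineq φ x hφ_nonneg
    hφ_pos hx
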